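/- Fix a non-principal ultrafilter $\mathcal U$ on $\mathbb N$, and for a set $Y$ let ${}^*Y=Y^{\mathbb N}/\mathcal U$ be its ultrapower. For a metric space $(Y,d)$, a point $p\in{}^*Y$ and a positive infinite $\nu\in{}^*\mathbb R$ (that is, $\nu>r$ for every $r\in\mathbb R$), the asymptotic cone $C(Y,p,\nu)$ is the set of those $x\in{}^*Y$ for which ${}^*d(x,p)/\nu$ is finite, where $x$ and $y$ are identified if ${}^*d(x,y)/\nu$ is infinitesimal, with the metric $d([x],[y])=\operatorname{st}\left({}^*d(x,y)/\nu\right)$, where $\operatorname{st}$ is the standard part. Let $G$ be a finitely generated group, and let $S=S^{-1}$ be a finite generating set of $G$. The Cayley graph of $G$ with respect to $S$ is the metric graph with vertex set $G$ and one edge of length $1$ between $g$ and $h$ whenever $gs=h$ for some $s\in S$, with the path metric. An asymptotic cone of $G$ is an asymptotic cone, with basepoint in ${}^*G$, of such a Cayley graph. A geodesic from $x$ to $y$ in a metric space $X$ is a curve $\gamma:[0,l]\to X$ with $\gamma(0)=x$, $\gamma(l)=y$ and $d(\gamma(s),\gamma(t))=|s-t|$ for all $s,t\in[0,l]$. A real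 tree is a complete metric space in which any two points are joined by a geodesic and in every geodesic triangle each side is contained in the union of the other two sides. The valency of a real tree $X$ at $p\in X$ is the number (cardinality of the set) of connected components of $X\setminus\{p\}$. Theorem. Let $X$ be a real tree that is isometric to an asymptotic cone of a finitely generated group. Then $X$ is a single point, or $X$ is isometric to the real line $\mathbb R$, or the valency of $X$ at every point is exactly $2^{\aleph_0}$. -/

import Mathlib

/-! ### Real trees -/

section RealTrees

variable {X : Type*} [MetricSpace X]

/-- `A` is (the image of) a geodesic from `x` to `y`, parametrized by arc length. -/
def IsGeodesicFromTo (x y : X) (A : Set X) : Prop :=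
  ∃ (l : ℝ) (γ : ℝ → X), 0 ≤ l ∧ γ 0 = x ∧ γ l = y ∧
    (∀ s ∈ Set.Icc 0 l, ∀ t ∈ Set.Icc 0 l, dist (γ s) (γ t) = |s - t|) ∧
    A = γ '' Set.Icc 0 l

variable (X) in
/-- A real tree: a complete geodesic metric space in which every side of every geodesic triangle
is contained in the union of the two other sides. -/
structure IsRealTree : Prop where
  complete : CompleteSpace X
  geodesic : ∀ x y : X, ∃ A, IsGeodesicFromTo x y A
  tripod : ∀ (x y z : X) (A B C : Set X), IsGeodesicFromTo x y A → IsGeodesicFromTo y z B →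
    IsGeodesicFromTo x z C → A ⊆ B ∪ C ∧ B ⊆ A ∪ C ∧ C ⊆ A ∪ B

/-- The valency at `p`: the number of connected components of the complement of `p`. -/
noncomputable def valency {X : Type*} [MetricSpace X] (p : X) : Cardinal :=
  Cardinal.mk (ConnectedComponents ↥({p}ᶜ : Set X))

end RealTrees

/-! ### Asymptotic cones -/

section Cones

/-- The nonstandard extension `*X` (ultrapower) with respect to the ultrafilter `U` on `ℕ`. -/
abbrev NSExt (U : Ultrafilter ℕ) (X : Type*) : Type _ := Filter.Germ (U : Filter ℕ) X

/-- A positive infinite number of `*ℝ`. -/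
def ScalingFactor (U : Ultrafilter ℕ) : Type :=
  {ν : NSExt U ℝ // ∀ r : ℝ, (r : NSExt U ℝ) < ν}

/-- An element of `*ℝ` is finite if its absolute value is less than some standard real. -/
def IsFiniteStar {U : Ultrafilter ℕ} (ξ : NSExt U ℝ) : Prop :=
  ∃ r : ℝ, |ξ| < (r : NSExt U ℝ)

/-- An element of `*ℝ` is infinitesimal if its absolute value is less than every positive
standard real. -/
def IsInfinitesimalStar {U : Ultrafilter ℕ} (ξ : NSExt U ℝ) : Prop :=
  ∀ r : ℝ, 0 < r → |ξ| < (r : NSExt U ℝ)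

/-- The embedding of `ℝ` into `*ℝ`. -/
def starRealHom (U : Ultrafilter ℕ) : ℝ →+*o NSExt U ℝ where
  toFun r := (r : NSExt U ℝ)
  map_one' := rfl
  map_mul' _ _ := rfl
  map_zero' := rfl
  map_add' _ _ := rfl
  monotone' _ _ h := Filter.Germ.const_le h

theorem isFiniteStar_iff {U : Ultrafilter ℕ} (ξ : NSExt U ℝ) :
    IsFiniteStar ξ ↔ 0 ≤ ArchimedeanClass.mk ξ := by
  constructor
  · rintro ⟨r, hr⟩
    have h1 : ArchimedeanClass.mk (starRealHom U r) ≤ ArchimedeanClass.mk ξ := by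
      apply ArchimedeanClass.mk_le_mk_of_abs
      exact hr.le.trans (le_abs_self _)
    exact (ArchimedeanClass.mk_map_nonneg_of_archimedean (starRealHom U) r).trans h1
  · intro h
    rw [← ArchimedeanClass.mk_one, ArchimedeanClass.mk_le_mk] at h
    obtain ⟨n, hn⟩ := h
    refine ⟨n + 1, hn.trans_lt ?_⟩
    have h2 : ((n + 1 : ℝ) : NSExt U ℝ) = (n : NSExt U ℝ) + 1 := by
      change starRealHom U (n + 1) = _
      rw [map_add, map_natCast, map_one]
    rw [h2]
    simp

variable {X : Type*} [MetricSpace X]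

/-- The extension `*d : *X × *X → *ℝ` of the distance of `X`. -/
def starDist {U : Ultrafilter ℕ} (x y : NSExt U X) : NSExt U ℝ :=
  Filter.Germ.map₂ dist x y

theorem starDist_self {U : Ultrafilter ℕ} (x : NSExt U X) : starDist x x = 0 := by
  induction x using Filter.Germ.inductionOn with | _ f =>
  exact congrArg _ (funext fun i => dist_self (f i))

theorem starDist_comm {U : Ultrafilter ℕ} (x y : NSExt U X) : starDist x y = starDist y x := by
  induction x, y using Filter.Germ.inductionOn₂ with | _ f g =>
  exact congrArg _ (funext fun i => dist_comm (f i) (g i))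

theorem starDist_triangle {U : Ultrafilter ℕ} (x y z : NSExt U X) :
    starDist x z ≤ starDist x y + starDist y z := by
  induction x, y, z using Filter.Germ.inductionOn₃ with | _ f g h =>
  exact Filter.Eventually.of_forall fun i => dist_triangle (f i) (g i) (h i)

theorem starDist_nonneg {U : Ultrafilter ℕ} (x y : NSExt U X) : 0 ≤ starDist x y := by
  induction x, y using Filter.Germ.inductionOn₂ with | _ f g =>
  exact Filter.Eventually.of_forall fun i => dist_nonneg

theorem ScalingFactor.pos {U : Ultrafilter ℕ} (ν : ScalingFactor U) : 0 < ν.1 := ν.2 0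

/-- The points `x` of `*X` with `*d(x, p) ∈ O(ν)`. -/
def PreCone {U : Ultrafilter ℕ} (p : NSExt U X) (ν : ScalingFactor U) : Type _ :=
  {x : NSExt U X // IsFiniteStar (starDist x p / ν.1)}

theorem PreCone.finite {U : Ultrafilter ℕ} {p : NSExt U X} {ν : ScalingFactor U}
    (x y : PreCone p ν) : IsFiniteStar (starDist x.1 y.1 / ν.1) := by
  obtain ⟨r, hr⟩ := x.2
  obtain ⟨s, hs⟩ := y.2
  refine ⟨r + s, ?_⟩
  have h (a b : NSExt U X) : 0 ≤ starDist a b / ν.1 := div_nonneg (starDist_nonneg a b) ν.pos.le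
  rw [abs_of_nonneg (h _ _)] at hr hs ⊢
  calc starDist x.1 y.1 / ν.1 ≤ (starDist x.1 p + starDist p y.1) / ν.1 :=
        div_le_div_of_nonneg_right (starDist_triangle _ _ _) ν.pos.le
    _ = starDist x.1 p / ν.1 + starDist y.1 p / ν.1 := by rw [add_div, starDist_comm p]
    _ < (r : NSExt U ℝ) + (s : NSExt U ℝ) := add_lt_add hr hs
    _ = _ := rfl

/-- The pseudodistance `st (*d(x, y) / ν)`. -/
noncomputable instance {U : Ultrafilter ℕ} (p : NSExt U X) (ν : ScalingFactor U) :
    PseudoMetricSpace (PreCone p ν) where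
  dist x y := ArchimedeanClass.stdPart (starDist x.1 y.1 / ν.1)
  dist_self x := by simp [starDist_self]
  dist_comm x y := by rw [starDist_comm]
  dist_triangle x y z := by
    have hf (a b : PreCone p ν) := (isFiniteStar_iff _).1 (PreCone.finite a b)
    rw [← ArchimedeanClass.stdPart_add (hf x y) (hf y z)]
    refine ArchimedeanClass.stdPart_monotoneOn (hf x z) ?_ ?_
    · exact (le_min (hf x y) (hf y z)).trans (ArchimedeanClass.min_le_mk_add _ _)
    · rw [← add_div]
      exact div_le_div_of_nonneg_right (starDist_triangle _ _ _) ν.pos.le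

theorem PreCone.dist_def {U : Ultrafilter ℕ} {p : NSExt U X} {ν : ScalingFactor U}
    (x y : PreCone p ν) : dist x y = ArchimedeanClass.stdPart (starDist x.1 y.1 / ν.1) := rfl

variable (X) in
/-- The asymptotic cone `C(X, p, ν)`: the points `x` of `*X` with `*d(x, p) ∈ O(ν)`, where `x` and
`y` are identified when `*d(x, y) ∈ o(ν)` (see `AsymptoticCone.mk_eq_mk_iff`), with the distance
`d([x], [y]) = st (*d(x, y) / ν)`. -/
def AsymptoticCone (U : Ultrafilter ℕ) (p : NSExt U X) (ν : ScalingFactor U) : Type _ :=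
  SeparationQuotient (PreCone p ν)

noncomputable instance {U : Ultrafilter ℕ} (p : NSExt U X) (ν : ScalingFactor U) :
    MetricSpace (AsymptoticCone X U p ν) :=
  inferInstanceAs (MetricSpace (SeparationQuotient (PreCone p ν)))

theorem AsymptoticCone.mk_eq_mk_iff {U : Ultrafilter ℕ} {p : NSExt U X} {ν : ScalingFactor U}
    (x y : PreCone p ν) :
    (SeparationQuotient.mk x : AsymptoticCone X U p ν) = SeparationQuotient.mk y ↔
      IsInfinitesimalStar (starDist x.1 y.1 / ν.1) := by
  refine SeparationQuotient.mk_eq_mk.trans (Metric.inseparable_iff.trans ?_)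
  rw [PreCone.dist_def]
  have hf := (isFiniteStar_iff _).1 (PreCone.finite x y)
  have h0 : 0 ≤ starDist x.1 y.1 / ν.1 := div_nonneg (starDist_nonneg _ _) ν.pos.le
  unfold IsInfinitesimalStar
  rw [abs_of_nonneg h0]
  generalize starDist x.1 y.1 / ν.1 = ξ at *
  constructor
  · intro h r hr
    exact ArchimedeanClass.lt_of_stdPart_lt (starRealHom U) hf (by rwa [h])
  · intro h
    refine ArchimedeanClass.stdPart_eq (starRealHom U) (fun s hs => ?_) (fun s hs => ?_)
    · exact ((starRealHom U).monotone' hs.le).trans (by simpa using h0)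
    · exact (h s hs).le

end Cones

/-! ### Cayley graphs -/

section Cayley

/-- A finite symmetric generating set of the group `G`. -/
structure FinGenSet (G : Type*) [Group G] where
  carrier : Set G
  finite : carrier.Finite
  inv_mem : ∀ s ∈ carrier, s⁻¹ ∈ carrier
  closure_eq_top : Subgroup.closure carrier = ⊤

variable {G : Type*} [Group G] (S : FinGenSet G)

/-- The distance of two vertices of the Cayley graph: the least number of edges of an edge path
between them, that is, the word distance. -/
noncomputable def FinGenSet.vdist (g h : G) : ℕ := (SimpleGraph.mulCayley S.carrier).dist g h

theorem FinGenSet.connected : (SimpleGraph.mulCayley S.carrier).Connected := by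
  have key : ∀ x : G, ∀ g : G, (SimpleGraph.mulCayley S.carrier).Reachable g (g * x) := by
    intro x
    have hx : x ∈ Subgroup.closure S.carrier := by rw [S.closure_eq_top]; trivial
    induction hx using Subgroup.closure_induction with
    | mem s hs =>
      intro g
      by_cases h : g = g * s
      · rw [← h]
      · exact SimpleGraph.Adj.reachable
          ((SimpleGraph.mulCayley_adj' _ _ _).2 ⟨h, s, hs, Or.inl rfl⟩)
    | one => intro g; rw [mul_one]
    | mul a b _ _ iha ihb =>
      intro g
      rw [← mul_assoc]
      exact (iha g).trans (ihb (g * a))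
    | inv a _ iha =>
      intro g
      simpa using (iha (g * a⁻¹)).symm
  refine SimpleGraph.Connected.mk fun g h => ?_
  simpa using key (g⁻¹ * h) g

/-- Names for the points of the Cayley graph: the vertices `g`, and the points at distance `t`
from `u` on the edge from `u` to `v = u s` (of length 1), for `s` in the generating set. -/
inductive CayleyPoint (S : FinGenSet G) : Type _
  | vertex (g : G) : CayleyPoint S
  | onEdge (u v : G) (h : ∃ s ∈ S.carrier, u * s = v) (t : ℝ) (ht : t ∈ Set.Icc (0 : ℝ) 1) :
      CayleyPoint S

namespace CayleyPoint

variable {S}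

/-- The length of a shortest path from a point to the vertex `w`. -/
noncomputable def distVertex : CayleyPoint S → G → ℝ
  | vertex g, w => S.vdist g w
  | onEdge u v _ t _, w => min (t + S.vdist u w) (1 - t + S.vdist v w)

/-- The length of a shortest path between two points among those through some vertex. -/
noncomputable def distThrough (x y : CayleyPoint S) : ℝ :=
  ⨅ w : G, (x.distVertex w + y.distVertex w)

open Classical in
/-- The path distance. Two points on the same edge (possibly traversed in opposite directions) are
also joined by a segment of this edge; all other paths go through a vertex. -/
noncomputable def pathDist (x y : CayleyPoint S) : ℝ :=
  match x, y with
  | onEdge u v _ t _, onEdge u' v' _ t' _ =>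
      if u = u' ∧ v = v' then min |t - t'| (distThrough x y)
      else if u = v' ∧ v = u' then min |t - (1 - t')| (distThrough x y)
      else distThrough x y
  | _, _ => distThrough x y

theorem vdist_triangle (u v w : G) : (S.vdist u w : ℝ) ≤ S.vdist u v + S.vdist v w := by
  exact_mod_cast S.connected.dist_triangle

theorem vdist_comm (u v : G) : S.vdist u v = S.vdist v u := SimpleGraph.dist_comm

theorem vdist_self (u : G) : S.vdist u u = 0 := SimpleGraph.dist_self

theorem vdist_edge {u v : G} (h : ∃ s ∈ S.carrier, u * s = v) : (S.vdist u v : ℝ) ≤ 1 := by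
  by_cases huv : u = v
  · subst huv; simp [vdist_self]
  · have : (SimpleGraph.mulCayley S.carrier).Adj u v := by
      obtain ⟨s, hs, h⟩ := h
      exact (SimpleGraph.mulCayley_adj' _ _ _).2 ⟨huv, s, hs, Or.inl h⟩
    have h1 : S.vdist u v = 1 := SimpleGraph.dist_eq_one_iff_adj.2 this
    simp [h1]

theorem distVertex_nonneg (x : CayleyPoint S) (w : G) : 0 ≤ x.distVertex w := by
  cases x with
  | vertex g => exact Nat.cast_nonneg _
  | onEdge u v h t ht =>
    have := ht.1
    have := ht.2
    exact le_min (by positivity) (add_nonneg (by linarith) (Nat.cast_nonneg _))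

theorem distVertex_le (x : CayleyPoint S) (v w : G) :
    x.distVertex w ≤ x.distVertex v + S.vdist v w := by
  cases x with
  | vertex g => exact vdist_triangle _ _ _
  | onEdge a b h t ht =>
    have h1 := vdist_triangle (S := S) a v w
    have h2 := vdist_triangle (S := S) b v w
    simp only [distVertex]
    grind

theorem vdist_le (x : CayleyPoint S) (v w : G) :
    S.vdist v w ≤ x.distVertex v + x.distVertex w := by
  cases x with
  | vertex g =>
    have := vdist_triangle (S := S) v g w
    rwa [vdist_comm v g] at this
  | onEdge a b h t ht =>
    have h0 := vdist_edge h
    have h1 := vdist_triangle (S := S) v a w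
    have h2 := vdist_triangle (S := S) v b w
    have h3 := vdist_triangle (S := S) a b w
    have h4 := vdist_triangle (S := S) b a w
    rw [vdist_comm v a] at h1
    rw [vdist_comm v b] at h2
    rw [vdist_comm b a] at h4
    obtain ⟨ht0, ht1⟩ := ht
    simp only [distVertex]
    grind

theorem bddBelow_distThrough (x y : CayleyPoint S) :
    BddBelow (Set.range fun w : G => x.distVertex w + y.distVertex w) :=
  ⟨0, by rintro _ ⟨w, rfl⟩; exact add_nonneg (distVertex_nonneg _ _) (distVertex_nonneg _ _)⟩

theorem distThrough_le (x y : CayleyPoint S) (w : G) :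
    distThrough x y ≤ x.distVertex w + y.distVertex w :=
  ciInf_le (bddBelow_distThrough x y) w

theorem distThrough_nonneg (x y : CayleyPoint S) : 0 ≤ distThrough x y :=
  le_ciInf fun _ => add_nonneg (distVertex_nonneg _ _) (distVertex_nonneg _ _)

theorem distThrough_comm (x y : CayleyPoint S) : distThrough x y = distThrough y x := by
  simp only [distThrough, add_comm]

theorem distThrough_triangle (x y z : CayleyPoint S) :
    distThrough x z ≤ distThrough x y + distThrough y z := by
  refine le_ciInf_add_ciInf fun v w => ?_
  have h1 := distThrough_le x z w
  have h2 := distVertex_le x v w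
  have h3 := vdist_le y v w
  linarith

theorem distThrough_le_add (x y z : CayleyPoint S) (d : ℝ)
    (h : ∀ w, z.distVertex w ≤ y.distVertex w + d) :
    distThrough x z ≤ distThrough x y + d := by
  rw [← sub_le_iff_le_add]
  refine le_ciInf fun w => ?_
  have := distThrough_le x z w
  have := h w
  linarith

theorem pathDist_le (x y : CayleyPoint S) : pathDist x y ≤ distThrough x y := by
  cases x <;> cases y <;> simp only [pathDist, le_refl]
  grind

theorem distVertex_le_add_pathDist (x y : CayleyPoint S) :
    pathDist x y = distThrough x y ∨ ∀ w, y.distVertex w ≤ x.distVertex w + pathDist x y := by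
  cases x <;> cases y <;> simp only [pathDist, true_or]
  simp only [distVertex]
  grind

theorem pathDist_comm (x y : CayleyPoint S) : pathDist x y = pathDist y x := by
  cases x <;> cases y <;> simp only [pathDist] <;> rw [distThrough_comm]
  grind

theorem pathDist_nonneg (x y : CayleyPoint S) : 0 ≤ pathDist x y := by
  have := distThrough_nonneg x y
  cases x <;> cases y <;> simp only [pathDist] <;> grind

theorem pathDist_self (x : CayleyPoint S) : pathDist x x = 0 := by
  refine le_antisymm ?_ (pathDist_nonneg x x)
  cases x with
  | vertex g =>
    have := distThrough_le (.vertex g : CayleyPoint S) (.vertex g) g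
    simpa [pathDist, distVertex, vdist_self] using this
  | onEdge => simp [pathDist]

theorem pathDist_triangle (x y z : CayleyPoint S) :
    pathDist x z ≤ pathDist x y + pathDist y z := by
  have hxz := pathDist_le x z
  rcases distVertex_le_add_pathDist y x with h1 | h1 <;>
    rcases distVertex_le_add_pathDist y z with h2 | h2
  · rw [pathDist_comm x y, h1, h2, distThrough_comm y x]
    exact hxz.trans (distThrough_triangle x y z)
  · rw [pathDist_comm x y, h1, distThrough_comm y x]
    exact hxz.trans (distThrough_le_add x y z _ h2)
  · rw [pathDist_comm x y, h2, distThrough_comm y z, add_comm]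
    rw [distThrough_comm] at hxz
    exact hxz.trans (distThrough_le_add z y x _ h1)
  · have h3 := distThrough_le_add x y z _ h2
    have h4 := distThrough_le_add z y x _ h1
    rw [distThrough_comm z x, distThrough_comm z y] at h4
    rw [pathDist_comm y x] at h4
    clear h1 h2
    cases x <;> cases y <;> cases z <;> simp only [pathDist] at * <;> grind

end CayleyPoint

noncomputable instance : PseudoMetricSpace (CayleyPoint S) where
  dist := CayleyPoint.pathDist
  dist_self := CayleyPoint.pathDist_self
  dist_comm := CayleyPoint.pathDist_comm
  dist_triangle := CayleyPoint.pathDist_triangle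

/-- The Cayley graph of `G` with respect to `S` as a metric graph with edges of length 1 and the
path metric. Names of the same point (at distance 0) are identified: the edge from `u` to `v` is
glued to the vertices `u` and `v`, and is the edge from `v` to `u` traversed backwards. -/
def CayleyGraph : Type _ := SeparationQuotient (CayleyPoint S)

noncomputable instance : MetricSpace (CayleyGraph S) :=
  inferInstanceAs (MetricSpace (SeparationQuotient (CayleyPoint S)))

/-- The vertex `g` of the Cayley graph. -/
noncomputable def CayleyGraph.vertex (g : G) : CayleyGraph S := SeparationQuotient.mk (CayleyPoint.vertex g)

/-- The asymptotic cone `C_S(G, g, ν)` of the group `G` with basepoint `g ∈ *G`. -/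
def GroupAsymptoticCone (S : FinGenSet G) (U : Ultrafilter ℕ) (g : NSExt U G) (ν : ScalingFactor U) :
    Type _ :=
  AsymptoticCone (CayleyGraph S) U (g.map (CayleyGraph.vertex S)) ν

noncomputable instance (S : FinGenSet G) (U : Ultrafilter ℕ) (g : NSExt U G)
    (ν : ScalingFactor U) : MetricSpace (GroupAsymptoticCone S U g ν) :=
  inferInstanceAs (MetricSpace (AsymptoticCone (CayleyGraph S) U _ ν))

end Cayley

/-!
The cone `X` is described by sequences of group elements: every point of the Cayley graph is within
distance `1` of a vertex, which is negligible after division by an infinite number, so the points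
of `X` are classes of sequences in `G`, with distance the limit along `U` of the rescaled word
distances (`exists_coneModel`). Left multiplication by sequences then shows that `X` is
homogeneous (`ConeModel.isIsometricallyHomogeneous`). The geometry of `X` enters through the
four-point condition (`IsRealTree.four_point`), by which "not being separated by `p`" is an
equivalence relation with open classes on the complement of `p`.

If no point of `X` separates three points from each other, then of any three points one lies between
the other two, so `X` embeds isometrically into the line by the signed distance to a point. By
completeness and homogeneity the image has no endpoint unless `X` is a point
(`IsRealTree.isometryEquiv_real`).

If some point does separate three points, then by homogeneity three branches of a fixed length `r`
issue from every point. Branches attached at distinct points of a short geodesic that starts at `p`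
give, for every `n` and `ε > 0`, `n` points at distance between `r` and `r + ε` from `p` and at
distance at least `2 * r` from each other (`IsRealTree.exists_separated_family`). As `X` is an
ultraproduct, a saturation argument yields `2 ^ ℵ₀` points at distance exactly `r` from `p` and at
distance `2 * r` from each other (`ConeModel.exists_separated_cantor`). These lie in different
components of the complement of `p`. There are no more than `2 ^ ℵ₀` components, because `X` is a
quotient of a set of sequences in the countable group `G`.
-/

/-! ### Geodesics and the four-point condition -/

/-- A point `p` lies between `a` and `b` if the triangle inequality for `a, p, b` is an
equality. -/
def IsBetween {X : Type*} [MetricSpace X] (a p b : X) : Prop :=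
  dist a p + dist p b = dist a b

theorem IsBetween.symm {X : Type*} [MetricSpace X] {a p b : X} (h : IsBetween a p b) :
    IsBetween b p a := by
  unfold IsBetween at *
  rw [dist_comm b p, dist_comm p a, dist_comm b a, ← h, add_comm]

/-- `γ`, restricted to `[0, dist x y]`, is a geodesic from `x` to `y`. -/
structure IsGeodesicMap {X : Type*} [MetricSpace X] (x y : X) (γ : ℝ → X) : Prop where
  start : γ 0 = x
  finish : γ (dist x y) = y
  dist_eq : ∀ s ∈ Set.Icc 0 (dist x y), ∀ t ∈ Set.Icc 0 (dist x y), dist (γ s) (γ t) = |s - t|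

namespace IsGeodesicMap

variable {X : Type*} [MetricSpace X] {x y : X} {γ : ℝ → X}

theorem isGeodesicFromTo (h : IsGeodesicMap x y γ) :
    IsGeodesicFromTo x y (γ '' Set.Icc 0 (dist x y)) :=
  ⟨dist x y, γ, dist_nonneg, h.start, h.finish, h.dist_eq, rfl⟩

theorem dist_left (h : IsGeodesicMap x y γ) {s : ℝ} (hs : s ∈ Set.Icc 0 (dist x y)) :
    dist x (γ s) = s := by
  have := h.dist_eq 0 ⟨le_rfl, dist_nonneg⟩ s hs
  rwa [h.start, zero_sub, abs_neg, abs_of_nonneg hs.1] at this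

theorem dist_right (h : IsGeodesicMap x y γ) {s : ℝ} (hs : s ∈ Set.Icc 0 (dist x y)) :
    dist (γ s) y = dist x y - s := by
  have := h.dist_eq s hs (dist x y) ⟨dist_nonneg, le_rfl⟩
  rwa [h.finish, abs_sub_comm, abs_of_nonneg (sub_nonneg.2 hs.2)] at this

end IsGeodesicMap

namespace IsRealTree

variable {X : Type*} [MetricSpace X]

theorem exists_geodesicMap (hX : IsRealTree X) (x y : X) : ∃ γ, IsGeodesicMap x y γ := by
  obtain ⟨_, l, γ, hl, h0, h1, hd, -⟩ := hX.geodesic x y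
  have hxy : dist x y = l := by
    rw [← h0, ← h1, hd 0 ⟨le_rfl, hl⟩ l ⟨hl, le_rfl⟩, zero_sub, abs_neg, abs_of_nonneg hl]
  exact ⟨γ, h0, by rw [hxy, h1], by rwa [hxy]⟩

/-- Two geodesics issuing from `p` agree before they reach the Gromov product of their
endpoints. -/
theorem geodesicMap_eq (hX : IsRealTree X) {p x y : X} {γ γ' : ℝ → X}
    (hγ : IsGeodesicMap p x γ) (hγ' : IsGeodesicMap p y γ') {s : ℝ} (hs : 0 ≤ s)
    (h : 2 * s < dist p x + dist p y - dist x y) : γ s = γ' s := by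
  obtain ⟨δ, hδ⟩ := hX.exists_geodesicMap x y
  have h1 := dist_triangle p y x
  have h2 := dist_triangle p x y
  rw [dist_comm y x] at h1
  have hsx : s ∈ Set.Icc 0 (dist p x) := ⟨hs, by linarith⟩
  have hmem := (hX.tripod p x y _ _ _ hγ.isGeodesicFromTo hδ.isGeodesicFromTo
    hγ'.isGeodesicFromTo).1 ⟨s, hsx, rfl⟩
  rcases hmem with ⟨t, ht, he⟩ | ⟨t, ht, he⟩
  · -- a common point of `[p, x]` and `[x, y]` is too far from `p`
    have h3 := hδ.dist_left ht
    have h4 := hδ.dist_right ht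
    have h5 := hγ.dist_right hsx
    have h6 := hγ.dist_left hsx
    rw [he, dist_comm] at h3
    rw [he] at h4
    have h7 := dist_triangle p (γ s) y
    linarith
  · have h3 := hγ'.dist_left ht
    rw [he, hγ.dist_left hsx] at h3
    rw [← he, h3]

/-- The four-point condition: a real tree is `0`-hyperbolic. -/
theorem four_point (hX : IsRealTree X) (p x y z : X) :
    dist x z + dist p y ≤ dist x y + dist p z ∨ dist x z + dist p y ≤ dist p x + dist y z := by
  by_contra! h
  obtain ⟨h1, h2⟩ := h
  obtain ⟨γ, hγ⟩ := hX.exists_geodesicMap p x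
  obtain ⟨δ, hδ⟩ := hX.exists_geodesicMap p y
  obtain ⟨ε, hε⟩ := hX.exists_geodesicMap p z
  obtain ⟨s, hs, hs'⟩ : ∃ s, (dist p x + dist p z - dist x z) / 2 < s ∧
      s < min ((dist p x + dist p y - dist x y) / 2) ((dist p y + dist p z - dist y z) / 2) :=
    exists_between (lt_min (by linarith) (by linarith))
  rw [lt_min_iff] at hs'
  have t1 := dist_triangle x p z
  have t2 := dist_triangle p y x
  have t3 := dist_triangle p y z
  rw [dist_comm x p] at t1
  rw [dist_comm y x] at t2
  have t4 := dist_triangle p x y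
  have t5 := dist_triangle p z y
  rw [dist_comm z y] at t5
  have h0 : 0 ≤ s := by linarith
  have e1 := hX.geodesicMap_eq hγ hδ h0 (by linarith)
  have e2 := hX.geodesicMap_eq hδ hε h0 (by linarith)
  have d1 := hγ.dist_right (s := s) ⟨h0, by linarith⟩
  have d2 := hε.dist_right (s := s) ⟨h0, by linarith⟩
  rw [dist_comm, e1, e2] at d1
  have := dist_triangle x (ε s) z
  linarith

/-- Lying in the same component of the complement of `p` is a transitive relation. -/
theorem not_isBetween_trans (hX : IsRealTree X) {p x y z : X} (hxy : ¬ IsBetween x p y)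
    (hyz : ¬ IsBetween y p z) : ¬ IsBetween x p z := by
  unfold IsBetween at *
  have h1 := dist_triangle x p y
  have h2 := dist_triangle y p z
  have h1' := lt_of_le_of_ne h1 (Ne.symm hxy)
  have h2' := lt_of_le_of_ne h2 (Ne.symm hyz)
  rw [dist_comm x p] at *
  rw [dist_comm y p] at *
  rcases hX.four_point p x y z with h | h <;> intro h3 <;> linarith

theorem exists_isBetween (hX : IsRealTree X) (x y : X) {s : ℝ} (hs : 0 ≤ s)
    (hs' : s ≤ dist x y) : ∃ z, dist x z = s ∧ IsBetween x z y := by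
  obtain ⟨γ, hγ⟩ := hX.exists_geodesicMap x y
  refine ⟨γ s, hγ.dist_left ⟨hs, hs'⟩, ?_⟩
  unfold IsBetween
  rw [hγ.dist_left ⟨hs, hs'⟩, hγ.dist_right ⟨hs, hs'⟩]
  ring

/-- Every three points of a real tree have a centre, lying between any two of them. -/
theorem exists_centre (hX : IsRealTree X) (a b c : X) :
    ∃ m, IsBetween a m b ∧ IsBetween a m c ∧ IsBetween b m c := by
  have t1 := dist_triangle a b c
  have t2 := dist_triangle a c b
  have t3 := dist_triangle b a c
  rw [dist_comm c b] at t2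
  rw [dist_comm b a] at t3
  obtain ⟨m, hm, hb⟩ := hX.exists_isBetween a b (s := (dist a b + dist a c - dist b c) / 2)
    (by linarith) (by linarith)
  have hf := hX.four_point c a m b
  have t4 := dist_triangle a m c
  have t5 := dist_triangle b m c
  unfold IsBetween at *
  rw [dist_comm c m, dist_comm c b, dist_comm c a] at hf
  rw [dist_comm b m] at t5
  refine ⟨m, hb, ?_, ?_⟩ <;> (try rw [dist_comm b m]) <;> rcases hf with hf | hf <;> linarith

/-! ### Components of the complement of a point -/

theorem not_isBetween_self {p x : X} (h : x ≠ p) : ¬ IsBetween x p x := by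
  unfold IsBetween
  rw [dist_comm p x, dist_self]
  have := dist_pos.2 h
  linarith

/-- Points separated by `p` lie in different components of the complement of `p`: the points not
separated from a given one form a clopen set. -/
theorem connectedComponents_ne (hX : IsRealTree X) {p : X} (x y : ({p}ᶜ : Set X))
    (h : IsBetween x.1 p y.1) :
    (x : ConnectedComponents ({p}ᶜ : Set X)) ≠ (y : ConnectedComponents ({p}ᶜ : Set X)) := by
  have near (z : ({p}ᶜ : Set X)) : ∀ w : ({p}ᶜ : Set X), dist w z < dist z.1 p →
      ¬ IsBetween w.1 p z.1 := by
    intro w hw hb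
    unfold IsBetween at hb
    rw [Subtype.dist_eq] at hw
    have : 0 ≤ dist w.1 p := dist_nonneg
    rw [dist_comm p z.1] at hb
    linarith
  have pos (z : ({p}ᶜ : Set X)) : 0 < dist z.1 p := dist_pos.2 z.2
  have hclopen : IsClopen {z : ({p}ᶜ : Set X) | ¬ IsBetween x.1 p z.1} := by
    constructor
    · rw [← isOpen_compl_iff, Metric.isOpen_iff]
      intro z hz
      refine ⟨_, pos z, fun w hw hw' => hz ?_⟩
      exact hX.not_isBetween_trans hw' (near z w hw)
    · rw [Metric.isOpen_iff]
      intro z hz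
      refine ⟨_, pos z, fun w hw => ?_⟩
      exact hX.not_isBetween_trans hz fun hb => near z w hw hb.symm
  rw [Ne, eq_comm, ConnectedComponents.coe_eq_coe']
  intro hy
  exact hclopen.connectedComponent_subset (not_isBetween_self x.2) hy h

end IsRealTree

/-! ### Homogeneous real trees without branching -/

/-- A weak form of homogeneity: every point is moved to every other one by a distance preserving
self-map, which need not be surjective. -/
def IsIsometricallyHomogeneous (X : Type*) [MetricSpace X] : Prop :=
  ∀ x y : X, ∃ φ : X → X, Isometry φ ∧ φ x = y

/-- `p` branches if it separates some three points from each other. -/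
def IsBranchPoint {X : Type*} [MetricSpace X] (p : X) : Prop :=
  ∃ a b c : X, a ≠ p ∧ b ≠ p ∧ c ≠ p ∧ IsBetween a p b ∧ IsBetween a p c ∧ IsBetween b p c

namespace IsRealTree

variable {X : Type*} [MetricSpace X]

/-- Without branch points, two points on the same side of `p` lie on a common ray from `p`. -/
theorem dist_eq_abs_sub (hX : IsRealTree X) (hb : ∀ p : X, ¬ IsBranchPoint p) {p x y : X}
    (h : ¬ IsBetween x p y) : dist x y = |dist x p - dist y p| := by
  obtain ⟨m, h1, h2, h3⟩ := hX.exists_centre x y p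
  by_cases hm1 : m = x
  · subst hm1
    unfold IsBetween at *
    rw [dist_comm y m] at h3
    rw [abs_sub_comm, abs_of_nonneg (by linarith [dist_nonneg (x := m) (y := y)])]
    linarith
  by_cases hm2 : m = y
  · subst hm2
    unfold IsBetween at *
    rw [abs_of_nonneg (by linarith [dist_nonneg (x := x) (y := m)])]
    linarith
  by_cases hm3 : m = p
  · subst hm3
    exact absurd h1 h
  exact absurd ⟨x, y, p, Ne.symm hm1, Ne.symm hm2, Ne.symm hm3, h1, h2, h3⟩ (hb m)

/-- A real tree without branch points embeds isometrically into the line, by the signed distance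
to any of its points. -/
theorem exists_isometry_real (hX : IsRealTree X) (hb : ∀ p : X, ¬ IsBranchPoint p) {p a : X}
    (hpa : a ≠ p) : ∃ f : X → ℝ, Isometry f := by
  classical
  refine ⟨fun x => if IsBetween x p a then -dist x p else dist x p, ?_⟩
  refine Isometry.of_dist_eq fun x y => ?_
  rw [Real.dist_eq]
  have same : ¬ IsBetween x p y → dist x y = |dist x p - dist y p| := hX.dist_eq_abs_sub hb
  have nx : 0 ≤ dist x p := dist_nonneg
  have ny : 0 ≤ dist y p := dist_nonneg
  by_cases hx : IsBetween x p a <;> by_cases hy : IsBetween y p a <;> simp only [hx, hy, if_true,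
    if_false]
  · have : dist x y = |dist x p - dist y p| := by
      by_cases hxy : IsBetween x p y
      · by_cases hxp : x = p
        · subst hxp; simp [dist_comm]
        by_cases hyp : y = p
        · subst hyp; simp
        exact absurd ⟨x, y, a, hxp, hyp, hpa, hxy, hx, hy⟩ (hb p)
      · exact same hxy
    rw [this, abs_sub_comm]
    congr 1
    ring
  · have hxy : IsBetween x p y := by
      by_contra hxy
      exact hX.not_isBetween_trans hxy hy hx
    rw [← neg_add', abs_neg, abs_of_nonneg (by linarith), ← hxy, dist_comm p y]
  · have hxy : IsBetween x p y := by
      by_contra hxy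
      exact hX.not_isBetween_trans (fun h => hxy h.symm) hx hy
    rw [sub_neg_eq_add, abs_of_nonneg (by linarith), ← hxy, dist_comm p y]
  · exact (same (hX.not_isBetween_trans hx fun h => hy h.symm)).symm

theorem isConnected_univ (hX : IsRealTree X) [Nonempty X] : IsConnected (Set.univ : Set X) := by
  refine ⟨Set.univ_nonempty, isPreconnected_of_forall_pair fun x _ y _ => ?_⟩
  obtain ⟨γ, hγ⟩ := hX.exists_geodesicMap x y
  refine ⟨γ '' Set.Icc 0 (dist x y), Set.subset_univ _, ⟨0, ⟨le_rfl, dist_nonneg⟩, hγ.start⟩,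
    ⟨_, ⟨dist_nonneg, le_rfl⟩, hγ.finish⟩, isPreconnected_Icc.image _ ?_⟩
  refine LipschitzOnWith.continuousOn (K := 1) (LipschitzOnWith.of_dist_le_mul fun s hs t ht => ?_)
  rw [hγ.dist_eq s hs t ht, NNReal.coe_one, one_mul, Real.dist_eq]

/-- If every point lies strictly between two others, the image of an isometry into the line is
not bounded above: by completeness its supremum would be attained. -/
theorem not_bddAbove_range (hX : IsRealTree X) [Nonempty X]
    (hs : ∀ q : X, ∃ u v : X, u ≠ q ∧ v ≠ q ∧ IsBetween u q v) {f : X → ℝ} (hf : Isometry f) :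
    ¬ BddAbove (Set.range f) := by
  intro hbdd
  have := hX.complete
  have hcl : IsClosed (Set.range f) := hf.isClosedEmbedding.isClosed_range
  obtain ⟨q, hq⟩ := hcl.csSup_mem (Set.range_nonempty f) hbdd
  have hle (x : X) : f x ≤ f q := hq ▸ le_csSup hbdd ⟨x, rfl⟩
  obtain ⟨u, v, hu, hv, huv⟩ := hs q
  unfold IsBetween at huv
  have h1 := dist_pos.2 hu
  have h2 := dist_pos.2 hv
  rw [dist_comm] at h2
  rw [← hf.dist_eq] at h1 h2
  rw [← hf.dist_eq, ← hf.dist_eq, ← hf.dist_eq] at huv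
  rw [Real.dist_eq] at h1 h2
  rw [Real.dist_eq, Real.dist_eq, Real.dist_eq, abs_of_nonpos (sub_nonpos.2 (hle u)),
    abs_of_nonneg (sub_nonneg.2 (hle v))] at huv
  rw [abs_of_nonpos (sub_nonpos.2 (hle u))] at h1
  rw [abs_of_nonneg (sub_nonneg.2 (hle v))] at h2
  rcases abs_cases (f u - f v) with h | h <;> linarith [h.1]

theorem isometryEquiv_real (hX : IsRealTree X) (hom : IsIsometricallyHomogeneous X)
    (hb : ∀ p : X, ¬ IsBranchPoint p) {p a : X} (hpa : a ≠ p) : Nonempty (X ≃ᵢ ℝ) := by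
  have : Nonempty X := ⟨p⟩
  obtain ⟨f, hf⟩ := hX.exists_isometry_real hb hpa
  have hs : ∀ q : X, ∃ u v : X, u ≠ q ∧ v ≠ q ∧ IsBetween u q v := by
    intro q
    have hd := dist_pos.2 hpa
    obtain ⟨m, hm, hbm⟩ := hX.exists_isBetween a p (s := dist a p / 2) (by linarith) (by linarith)
    obtain ⟨φ, hφ, rfl⟩ := hom m q
    unfold IsBetween at *
    refine ⟨φ a, φ p, ?_, ?_, ?_⟩
    · rw [← dist_pos, hφ.dist_eq]; linarith
    · rw [← dist_pos, hφ.dist_eq, dist_comm]; linarith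
    · rw [hφ.dist_eq, hφ.dist_eq, hφ.dist_eq, hbm]
  have hsurj : Function.Surjective f := by
    have hab := hX.not_bddAbove_range hs hf
    have hbl := hX.not_bddAbove_range hs (f := fun x => -f x)
      (Isometry.of_dist_eq fun x y => by rw [dist_neg_neg, hf.dist_eq])
    intro t
    obtain ⟨_, ⟨x, rfl⟩, hx⟩ := not_bddAbove_iff.1 hab t
    obtain ⟨_, ⟨y, rfl⟩, hy⟩ := not_bddAbove_iff.1 hbl (-t)
    have hpre := hX.isConnected_univ.isPreconnected.image f hf.continuous.continuousOn
    rw [Set.image_univ] at hpre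
    exact hpre.ordConnected.out ⟨y, rfl⟩ ⟨x, rfl⟩ ⟨by linarith, hx.le⟩
  exact ⟨IsometryEquiv.mk (Equiv.ofBijective f ⟨hf.injective, hsurj⟩) hf⟩

/-! ### Homogeneous real trees with branching -/

/-- By homogeneity, branching happens everywhere, with branches of a uniform length. -/
theorem exists_uniform_branches (hX : IsRealTree X) (hom : IsIsometricallyHomogeneous X) {p : X}
    (hp : IsBranchPoint p) : ∃ r > 0, ∀ q : X, ∃ a b c : X, dist a q = r ∧ dist b q = r ∧
      dist c q = r ∧ IsBetween a q b ∧ IsBetween a q c ∧ IsBetween b q c := by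
  obtain ⟨a, b, c, ha, hb, hc, hab, hac, hbc⟩ := hp
  obtain ⟨r, hr, hra, hrb, hrc⟩ : ∃ r > 0, r ≤ dist p a ∧ r ≤ dist p b ∧ r ≤ dist p c :=
    ⟨min (dist p a) (min (dist p b) (dist p c)),
      lt_min (dist_pos.2 ha.symm) (lt_min (dist_pos.2 hb.symm) (dist_pos.2 hc.symm)),
      min_le_left _ _, (min_le_right _ _).trans (min_le_left _ _),
      (min_le_right _ _).trans (min_le_right _ _)⟩
  refine ⟨r, hr, fun q => ?_⟩
  obtain ⟨a', ha', hba⟩ := hX.exists_isBetween p a hr.le hra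
  obtain ⟨b', hb', hbb⟩ := hX.exists_isBetween p b hr.le hrb
  obtain ⟨c', hc', hbc'⟩ := hX.exists_isBetween p c hr.le hrc
  have key : ∀ {x x' y y' : X}, IsBetween p x' x → IsBetween p y' y → IsBetween x p y →
      IsBetween x' p y' := by
    intro x x' y y' h1 h2 h3
    unfold IsBetween at *
    have t1 := dist_triangle x x' y
    have t2 := dist_triangle x' y' y
    have t3 := dist_triangle x' p y'
    rw [dist_comm x p] at h3
    rw [dist_comm x x'] at t1
    rw [dist_comm x' p] at *
    linarith
  obtain ⟨φ, hφ, rfl⟩ := hom p q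
  refine ⟨φ a', φ b', φ c', ?_, ?_, ?_, ?_, ?_, ?_⟩
  · rw [hφ.dist_eq, dist_comm, ha']
  · rw [hφ.dist_eq, dist_comm, hb']
  · rw [hφ.dist_eq, dist_comm, hc']
  all_goals
    unfold IsBetween at *
    simp only [hφ.dist_eq]
  · exact key hba hbb hab
  · exact key hba hbc' hac
  · exact key hbb hbc' hbc

/-- Of three branches at `q`, one contains neither of two given points. -/
theorem exists_branch_avoiding (hX : IsRealTree X) {q : X} {r : ℝ}
    (h : ∃ a b c : X, dist a q = r ∧ dist b q = r ∧
      dist c q = r ∧ IsBetween a q b ∧ IsBetween a q c ∧ IsBetween b q c) (u v : X) :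
    ∃ x, dist x q = r ∧ IsBetween x q u ∧ IsBetween x q v := by
  obtain ⟨a, b, c, ha, hb, hc, hab, hac, hbc⟩ := h
  have key (w : X) {x y : X} (hxy : IsBetween x q y) : IsBetween x q w ∨ IsBetween y q w := by
    by_contra! hn
    exact hX.not_isBetween_trans hn.1 (fun h => hn.2 h.symm) hxy
  have h1 := key u hab
  have h2 := key u hac
  have h3 := key u hbc
  have h4 := key v hab
  have h5 := key v hac
  have h6 := key v hbc
  by_cases a1 : IsBetween a q u ∧ IsBetween a q v
  · exact ⟨a, ha, a1⟩
  by_cases b1 : IsBetween b q u ∧ IsBetween b q v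
  · exact ⟨b, hb, b1⟩
  exact ⟨c, hc, by tauto⟩

/-- If there are three branches of length `r` at every point, then arbitrarily many branches of
length about `r` issue from points arbitrarily close to `p`: they are attached at distinct points
of a short geodesic starting at `p`. -/
theorem exists_separated_family (hX : IsRealTree X) {r : ℝ} (hr : 0 < r)
    (h : ∀ q : X, ∃ a b c : X, dist a q = r ∧ dist b q = r ∧
      dist c q = r ∧ IsBetween a q b ∧ IsBetween a q c ∧ IsBetween b q c)
    (p : X) {ε : ℝ} (hε : 0 < ε) (N : ℕ) :
    ∃ x : Fin N → X, (∀ j, r ≤ dist (x j) p ∧ dist (x j) p ≤ r + ε) ∧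
      ∀ j k, j ≠ k → 2 * r ≤ dist (x j) (x k) := by
  obtain ⟨a, -, -, ha, -⟩ := h p
  rw [dist_comm] at ha
  obtain ⟨γ, hγ⟩ := hX.exists_geodesicMap p a
  have hη : 0 < min ε r := lt_min hε hr
  -- the attaching points are `γ (s j)`
  let s : Fin N → ℝ := fun j => min ε r * ((j : ℝ) + 1) / N
  have hN (j : Fin N) : (0 : ℝ) < N := by exact_mod_cast j.pos
  have hs0 (j : Fin N) : 0 < s j := by have := hN j; positivity
  have hs1 (j : Fin N) : s j ≤ min ε r := by
    rw [div_le_iff₀ (hN j)]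
    have : (j : ℝ) + 1 ≤ N := by exact_mod_cast j.2
    gcongr
  have hs2 {j k : Fin N} (hjk : j < k) : s j < s k := by
    have : (j : ℝ) < k := by exact_mod_cast hjk
    have := hN j
    simp only [s]
    gcongr
  have hmem (j : Fin N) : s j ∈ Set.Icc 0 (dist p a) :=
    ⟨(hs0 j).le, ha ▸ (hs1 j).trans (min_le_right _ _)⟩
  choose x hx1 hx2 hx3 using fun j => hX.exists_branch_avoiding (h (γ (s j))) p a
  have hxp (j : Fin N) : dist (x j) p = r + s j := by
    have := hx2 j
    unfold IsBetween at this
    rw [← this, hx1, dist_comm (γ (s j)), hγ.dist_left (hmem j)]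
  refine ⟨x, fun j => ?_, ?_⟩
  · rw [hxp]
    have := hs0 j
    have := (hs1 j).trans (min_le_left _ _)
    constructor <;> linarith
  have key {j k : Fin N} (hjk : j < k) : 2 * r ≤ dist (x j) (x k) := by
    have hd : dist (γ (s j)) (γ (s k)) = s k - s j := by
      rw [hγ.dist_eq _ (hmem j) _ (hmem k), abs_sub_comm,
        abs_of_pos (sub_pos.2 (hs2 hjk))]
    have hlt := hs2 hjk
    have d1 := hγ.dist_left (hmem j)
    have d2 := hγ.dist_left (hmem k)
    have d3 := hγ.dist_right (hmem j)
    have d4 := hγ.dist_right (hmem k)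
    -- `x j` branches off before `γ (s k)`
    have b1 : IsBetween (x j) (γ (s j)) (γ (s k)) := by
      by_contra hn
      refine hX.not_isBetween_trans hn (z := a) ?_ (hx3 j)
      unfold IsBetween
      rw [dist_comm (γ (s k)), hd, d3, d4]
      intro; linarith
    have b2 : IsBetween (x k) (γ (s k)) (x j) := by
      by_contra hn
      have n1 : ¬ IsBetween (x j) (γ (s k)) (γ (s j)) := by
        unfold IsBetween at *
        rw [dist_comm (γ (s k)), ← b1, hd]
        intro; linarith
      have n2 : ¬ IsBetween (γ (s j)) (γ (s k)) p := by
        unfold IsBetween at *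
        rw [hd, dist_comm _ p, dist_comm _ p, d1, d2]
        intro; linarith
      exact hX.not_isBetween_trans hn (hX.not_isBetween_trans n1 n2) (hx2 k)
    unfold IsBetween at b1 b2
    rw [dist_comm, ← b2, dist_comm (γ (s k)), ← b1, hx1, hx1, hd]
    linarith
  intro j k hjk
  rcases lt_or_gt_of_ne hjk with hlt | hlt
  · exact key hlt
  · rw [dist_comm]; exact key hlt

end IsRealTree

/-! ### Word distance and the vertices of the Cayley graph -/

section Vertices

variable {G : Type*} [Group G] (S : FinGenSet G)

theorem FinGenSet.vdist_mul_left (h a b : G) : S.vdist (h * a) (h * b) = S.vdist a b := by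
  have key (h a b : G) : S.vdist (h * a) (h * b) ≤ S.vdist a b := by
    obtain ⟨w, hw⟩ := S.connected.exists_walk_length_eq_dist a b
    let φ : SimpleGraph.mulCayley S.carrier →g SimpleGraph.mulCayley S.carrier :=
      ⟨fun x => h * x, fun {_ _} hadj => SimpleGraph.mulCayley_adj_mul_iff_right.2 hadj⟩
    have := SimpleGraph.dist_le (w.map φ)
    rw [SimpleGraph.Walk.length_map, hw] at this
    exact this
  refine le_antisymm (key h a b) ?_
  simpa using key h⁻¹ (h * a) (h * b)

theorem FinGenSet.countable {G : Type*} [Group G] (S : FinGenSet G) : Countable G := by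
  have : Countable S.carrier := S.finite.countable
  have hsurj : Function.Surjective (FreeGroup.lift ((↑) : S.carrier → G)) := by
    rw [← MonoidHom.range_eq_top, FreeGroup.range_lift_eq_closure, Subtype.range_coe,
      S.closure_eq_top]
  exact hsurj.countable

theorem CayleyGraph.dist_vertex (a b : G) :
    dist (CayleyGraph.vertex S a) (CayleyGraph.vertex S b) = S.vdist a b := by
  change CayleyPoint.distThrough (.vertex a : CayleyPoint S) (.vertex b) = _
  refine le_antisymm ?_ (le_ciInf fun w => ?_)
  · have := CayleyPoint.distThrough_le (.vertex a : CayleyPoint S) (.vertex b) b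
    simpa [CayleyPoint.distVertex, CayleyPoint.vdist_self] using this
  · have := CayleyPoint.vdist_triangle (S := S) a w b
    rw [CayleyPoint.vdist_comm w b] at this
    exact this

theorem CayleyGraph.exists_dist_vertex_le (x : CayleyGraph S) :
    ∃ a : G, dist x (CayleyGraph.vertex S a) ≤ 1 := by
  obtain ⟨x, rfl⟩ := SeparationQuotient.surjective_mk x
  cases x with
  | vertex a =>
    refine ⟨a, ?_⟩
    change dist (CayleyGraph.vertex S a) (CayleyGraph.vertex S a) ≤ 1
    rw [dist_self]
    exact zero_le_one
  | onEdge u v h t ht =>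
    refine ⟨u, ?_⟩
    change CayleyPoint.distThrough (.onEdge u v h t ht : CayleyPoint S) (.vertex u) ≤ 1
    refine (CayleyPoint.distThrough_le _ _ u).trans ?_
    simp only [CayleyPoint.distVertex, CayleyPoint.vdist_self, Nat.cast_zero, add_zero]
    exact (min_le_left _ _).trans ht.2

end Vertices

/-! ### Points of the asymptotic cone as sequences of group elements -/

open Filter Topology

theorem tendsto_stdPart {U : Ultrafilter ℕ} {a : ℕ → ℝ}
    (h : IsFiniteStar ((a : Germ (U : Filter ℕ) ℝ) : NSExt U ℝ)) :
    Tendsto a U (𝓝 (ArchimedeanClass.stdPart ((a : Germ (U : Filter ℕ) ℝ) : NSExt U ℝ))) := by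
  have hf := (isFiniteStar_iff _).1 h
  rw [tendsto_order]
  constructor
  · intro r hr
    exact Germ.coe_lt.1 (ArchimedeanClass.lt_of_lt_stdPart (starRealHom U) hf hr)
  · intro r hr
    exact Germ.coe_lt.1 (ArchimedeanClass.lt_of_stdPart_lt (starRealHom U) hf hr)

/-- A description of the metric space `X` as the ultralimit, along `U`, of the group with the word
distance divided by `ν i`. A point of `X` is the class of a sequence of group elements at distance
`O(ν i)` from `g i`. -/
structure ConeModel {G : Type*} [Group G] (S : FinGenSet G) (U : Ultrafilter ℕ) (X : Type*)
    [MetricSpace X] where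
  ν : ℕ → ℝ
  ν_pos : ∀ᶠ i in U, 0 < ν i
  g : ℕ → G
  /-- The point represented by a sequence; the value is meaningful only for sequences satisfying
  `IsBounded`. -/
  point : (ℕ → G) → X
  surj : ∀ x : X, ∃ f, (∃ C, ∀ᶠ i in U, S.vdist (f i) (g i) / ν i ≤ C) ∧ point f = x
  tendsto : ∀ f f' : ℕ → G, (∃ C, ∀ᶠ i in U, S.vdist (f i) (g i) / ν i ≤ C) →
    (∃ C, ∀ᶠ i in U, S.vdist (f' i) (g i) / ν i ≤ C) →
    Tendsto (fun i => S.vdist (f i) (f' i) / ν i) U (𝓝 (dist (point f) (point f')))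

theorem exists_coneModel {G : Type*} [Group G] (S : FinGenSet G) (U : Ultrafilter ℕ)
    (g : NSExt U G) (ν : ScalingFactor U) {X : Type*} [MetricSpace X]
    (e : X ≃ᵢ GroupAsymptoticCone S U g ν) : Nonempty (ConeModel S U X) := by
  classical
  induction g using Germ.inductionOn with | _ g =>
  rename' ν => ν'
  obtain ⟨ν, hν⟩ : ∃ ν : ℕ → ℝ, (ν : Germ (U : Filter ℕ) ℝ) = ν'.1 := Quotient.exists_rep ν'.1
  have hr (r : ℝ) : ∀ᶠ i in U, r < ν i := Germ.coe_lt.1 (hν ▸ ν'.2 r)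
  let p : NSExt U (CayleyGraph S) :=
    Germ.map (CayleyGraph.vertex S) (g : Germ (U : Filter ℕ) G)
  let germ (f : ℕ → G) : NSExt U (CayleyGraph S) :=
    ((fun i => CayleyGraph.vertex S (f i) : ℕ → CayleyGraph S) : Germ (U : Filter ℕ) _)
  have hgerm (f f' : ℕ → G) : starDist (germ f) (germ f') / ν'.1 =
      ((fun i => S.vdist (f i) (f' i) / ν i : ℕ → ℝ) : Germ (U : Filter ℕ) ℝ) := by
    have : starDist (germ f) (germ f') =
        ((fun i => (S.vdist (f i) (f' i) : ℝ) : ℕ → ℝ) : Germ (U : Filter ℕ) ℝ) :=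
      congrArg _ (funext fun i => CayleyGraph.dist_vertex S (f i) (f' i))
    rw [this, ← hν]
    rfl
  have hfin (f : ℕ → G) : (∃ C, ∀ᶠ i in U, S.vdist (f i) (g i) / ν i ≤ C) →
      IsFiniteStar (starDist (germ f) p / ν'.1) := by
    rintro ⟨C, hC⟩
    refine ⟨C + 1, ?_⟩
    rw [abs_of_nonneg (div_nonneg (starDist_nonneg _ _) ν'.pos.le)]
    change starDist (germ f) (germ g) / ν'.1 < _
    rw [hgerm]
    exact Germ.coe_lt.2 (hC.mono fun i hi => hi.trans_lt (lt_add_one C))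
  let pt (f : ℕ → G) : PreCone p ν' :=
    if h : ∃ C, ∀ᶠ i in U, S.vdist (f i) (g i) / ν i ≤ C then ⟨germ f, hfin f h⟩
    else ⟨germ g, hfin g ⟨0, by simp [CayleyPoint.vdist_self]⟩⟩
  have hpt (f : ℕ → G) (h : ∃ C, ∀ᶠ i in U, S.vdist (f i) (g i) / ν i ≤ C) :
      (pt f).1 = germ f := congrArg Subtype.val (dif_pos h)
  let cpt (f : ℕ → G) : GroupAsymptoticCone S U (g : Germ (U : Filter ℕ) G) ν' :=
    (SeparationQuotient.mk (pt f) : AsymptoticCone (CayleyGraph S) U p ν')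
  refine ⟨⟨ν, hr 0, g, fun f => e.symm (cpt f), fun x => ?_, fun f f' hf hf' => ?_⟩⟩
  · obtain ⟨y, hy⟩ := SeparationQuotient.surjective_mk
      (e x : AsymptoticCone (CayleyGraph S) U p ν')
    obtain ⟨y, hyf⟩ := y
    induction y using Germ.inductionOn with | _ y =>
    choose f hf using fun i => CayleyGraph.exists_dist_vertex_le S (y i)
    have hb : ∃ C, ∀ᶠ i in U, S.vdist (f i) (g i) / ν i ≤ C := by
      obtain ⟨C, hC⟩ := hyf
      rw [← hν] at hC
      have hC' : ∀ᶠ i in U, |dist (y i) (CayleyGraph.vertex S (g i)) / ν i| < C :=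
        Germ.coe_lt.1 hC
      refine ⟨C + 1, ?_⟩
      filter_upwards [hC', hr 1] with i h1 h2
      have h3 := (le_abs_self _).trans h1.le
      have h0 : 0 < ν i := by linarith
      rw [div_le_iff₀ h0] at h3 ⊢
      rw [← CayleyGraph.dist_vertex]
      have h4 := dist_triangle_left (CayleyGraph.vertex S (f i)) (CayleyGraph.vertex S (g i)) (y i)
      have := hf i
      linarith
    refine ⟨f, hb, ?_⟩
    rw [IsometryEquiv.symm_apply_eq]
    refine Eq.trans ?_ hy
    refine (AsymptoticCone.mk_eq_mk_iff _ _).2 fun r hr0 => ?_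
    rw [abs_of_nonneg (div_nonneg (starDist_nonneg _ _) ν'.pos.le)]
    rw [hpt f hb]
    change starDist (germ f) (y : Germ (U : Filter ℕ) (CayleyGraph S)) / ν'.1 < _
    rw [← hν]
    refine Germ.coe_lt.2 ?_
    filter_upwards [hr (1 / r), hr 1] with i h1 h2
    change dist (CayleyGraph.vertex S (f i)) (y i) / ν i < r
    rw [div_lt_iff₀ hr0] at h1
    rw [div_lt_iff₀ (by linarith), dist_comm]
    have := hf i
    linarith
  · rw [e.symm.dist_eq]
    have h1 : dist (cpt f) (cpt f') =
        ArchimedeanClass.stdPart (starDist (pt f).1 (pt f').1 / ν'.1) := rfl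
    have h2 := PreCone.finite (pt f) (pt f')
    rw [hpt f hf, hpt f' hf', hgerm] at h1 h2
    rw [h1]
    exact tendsto_stdPart h2

namespace ConeModel

variable {G : Type*} [Group G] {S : FinGenSet G} {U : Ultrafilter ℕ} {X : Type*} [MetricSpace X]
  (M : ConeModel S U X)

/-- The sequences that represent a point: those at distance `O(ν i)` from `g i`. -/
def IsBounded (f : ℕ → G) : Prop := ∃ C, ∀ᶠ i in U, S.vdist (f i) (M.g i) / M.ν i ≤ C

variable {M} in
theorem IsBounded.of_dist {f f' : ℕ → G} (hf : M.IsBounded f) {D : ℝ}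
    (h : ∀ᶠ i in U, S.vdist (f' i) (f i) / M.ν i ≤ D) : M.IsBounded f' := by
  obtain ⟨C, hC⟩ := hf
  refine ⟨D + C, ?_⟩
  filter_upwards [hC, h, M.ν_pos] with i h1 h2 h3
  have := CayleyPoint.vdist_triangle (S := S) (f' i) (f i) (M.g i)
  calc (S.vdist (f' i) (M.g i) : ℝ) / M.ν i
      ≤ (S.vdist (f' i) (f i) + S.vdist (f i) (M.g i)) / M.ν i := by gcongr
    _ ≤ D + C := by rw [add_div]; exact add_le_add h2 h1

/-- Left multiplication by a sequence of group elements that takes a representative of `x` to one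
of `y` preserves the word distances, hence the distance of `X`. -/
theorem isIsometricallyHomogeneous (M : ConeModel S U X) : IsIsometricallyHomogeneous X := by
  intro x y
  obtain ⟨u, hu, rfl⟩ := M.surj x
  obtain ⟨v, hv, rfl⟩ := M.surj y
  choose rep hrep hpt using M.surj
  have hb (f : ℕ → G) (hf : M.IsBounded f) :
      M.IsBounded fun i => v i * (u i)⁻¹ * f i := by
    have h1 := M.tendsto f u hf hu
    refine IsBounded.of_dist (f := v) hv
      (D := dist (M.point f) (M.point u) + 1) ?_
    filter_upwards [h1.eventually_lt_const (lt_add_one _)] with i hi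
    have := S.vdist_mul_left (v i * (u i)⁻¹) (f i) (u i)
    rw [inv_mul_cancel_right] at this
    rw [this]
    exact hi.le
  have hd (f f' : ℕ → G) (hf : M.IsBounded f) (hf' : M.IsBounded f') :
      dist (M.point fun i => v i * (u i)⁻¹ * f i) (M.point fun i => v i * (u i)⁻¹ * f' i) =
        dist (M.point f) (M.point f') := by
    have h1 := M.tendsto _ _ (hb f hf) (hb f' hf')
    simp only [S.vdist_mul_left] at h1
    exact tendsto_nhds_unique h1 (M.tendsto f f' hf hf')
  refine ⟨fun z => M.point fun i => v i * (u i)⁻¹ * rep z i, Isometry.of_dist_eq fun z w => ?_, ?_⟩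
  · rw [hd _ _ (hrep z) (hrep w), hpt, hpt]
  · have h1 := hd _ _ (hrep (M.point u)) hu
    rw [hpt, dist_self, dist_eq_zero] at h1
    refine h1.trans (congrArg M.point (funext fun i => ?_))
    rw [inv_mul_cancel_right]

theorem mk_le_continuum (M : ConeModel S U X) : Cardinal.mk X ≤ Cardinal.continuum := by
  have := S.countable
  obtain ⟨ι, hι⟩ := exists_injective_nat G
  choose rep _ hpt using M.surj
  have hinj : Function.Injective fun (x : X) (i : ℕ) => ι (rep x i) := by
    intro x y hxy
    rw [← hpt x, ← hpt y]
    congr 1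
    funext i
    exact hι (congrFun hxy i)
  have := Cardinal.lift_mk_le_lift_mk_of_injective hinj
  simpa using this

end ConeModel

/-! ### Saturation -/

namespace ConeModel

variable {G : Type*} [Group G] {S : FinGenSet G} {U : Ultrafilter ℕ} {X : Type*} [MetricSpace X]

/-- If for every `n` there are `2 ^ n` points which are, up to `1 / (n + 1)`, at distance `r` from
`p` and at distance at least `2 * r` from each other, then there are `2 ^ ℵ₀` points for which this
holds exactly. At the index `i` take `2 ^ N i` suitable group elements, where `N i` is as large as
possible, but at most `i`; an infinite binary sequence selects one of them by its first `N i`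
terms. -/
theorem exists_separated_cantor (M : ConeModel S U X) (hU : (U : Filter ℕ) ≤ Filter.cofinite)
    {r : ℝ} (p : X)
    (h : ∀ n : ℕ, ∃ x : (Fin n → Bool) → X,
      (∀ s, r ≤ dist (x s) p ∧ dist (x s) p ≤ r + 1 / ((n : ℝ) + 1)) ∧
      ∀ s t, s ≠ t → 2 * r ≤ dist (x s) (x t)) :
    ∃ x : (ℕ → Bool) → X, (∀ s, dist (x s) p = r) ∧ ∀ s t, s ≠ t → 2 * r ≤ dist (x s) (x t) := by
  classical
  obtain ⟨q, hq, rfl⟩ := M.surj p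
  have hcof : Tendsto id (U : Filter ℕ) atTop := by rw [← Nat.cofinite_eq_atTop]; exact hU
  let P (i n : ℕ) : Prop := ∃ y : (Fin n → Bool) → G,
    (∀ s, r - 1 / ((n : ℝ) + 1) ≤ S.vdist (y s) (q i) / M.ν i ∧
      S.vdist (y s) (q i) / M.ν i ≤ r + 2 * (1 / ((n : ℝ) + 1))) ∧
    ∀ s t, s ≠ t → 2 * r - 1 / ((n : ℝ) + 1) ≤ S.vdist (y s) (y t) / M.ν i
  have hP (n : ℕ) : ∀ᶠ i in U, P i n := by
    obtain ⟨x, hx1, hx2⟩ := h n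
    have hε : (0 : ℝ) < 1 / ((n : ℝ) + 1) := by positivity
    choose y hy hxy using fun s => M.surj (x s)
    have h1 : ∀ᶠ i in U, ∀ s, r - 1 / ((n : ℝ) + 1) ≤ S.vdist (y s i) (q i) / M.ν i ∧
        S.vdist (y s i) (q i) / M.ν i ≤ r + 2 * (1 / ((n : ℝ) + 1)) := by
      refine eventually_all.2 fun s => ?_
      have ht := M.tendsto _ _ (hy s) hq
      rw [hxy] at ht
      obtain ⟨l1, l2⟩ := hx1 s
      exact ((ht.eventually_const_lt (u := r - 1 / ((n : ℝ) + 1)) (by linarith)).and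
        (ht.eventually_lt_const (u := r + 2 * (1 / ((n : ℝ) + 1))) (by linarith))).mono
        fun i hi => ⟨hi.1.le, hi.2.le⟩
    have h2 : ∀ᶠ i in U, ∀ s t, s ≠ t →
        2 * r - 1 / ((n : ℝ) + 1) ≤ S.vdist (y s i) (y t i) / M.ν i := by
      refine eventually_all.2 fun s => eventually_all.2 fun t => ?_
      by_cases hst : s = t
      · exact Eventually.of_forall fun i hne => absurd hst hne
      have ht := M.tendsto _ _ (hy s) (hy t)
      rw [hxy, hxy] at ht
      have l := hx2 s t hst
      exact (ht.eventually_const_lt (u := 2 * r - 1 / ((n : ℝ) + 1)) (by linarith)).mono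
        fun i hi _ => hi.le
    filter_upwards [h1, h2] with i hi1 hi2
    exact ⟨fun s => y s i, hi1, hi2⟩
  let N (i : ℕ) : ℕ := Nat.findGreatest (P i) i
  have hN : Tendsto N U atTop := by
    refine tendsto_atTop.2 fun n => ?_
    filter_upwards [hP n, hcof.eventually_ge_atTop n] with i h1 h2
    exact Nat.le_findGreatest h2 h1
  have hPN : ∀ᶠ i in U, P i (N i) := by
    filter_upwards [hP 0] with i hi
    exact Nat.findGreatest_spec (Nat.zero_le i) hi
  have hy (i : ℕ) : ∃ y : (Fin (N i) → Bool) → G, P i (N i) →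
      (∀ s, r - 1 / ((N i : ℝ) + 1) ≤ S.vdist (y s) (q i) / M.ν i ∧
        S.vdist (y s) (q i) / M.ν i ≤ r + 2 * (1 / ((N i : ℝ) + 1))) ∧
      ∀ s t, s ≠ t → 2 * r - 1 / ((N i : ℝ) + 1) ≤ S.vdist (y s) (y t) / M.ν i := by
    by_cases hi : P i (N i)
    · exact ⟨hi.choose, fun _ => hi.choose_spec⟩
    · exact ⟨fun _ => 1, fun h => absurd h hi⟩
  choose y hy using hy
  let f (s : ℕ → Bool) (i : ℕ) : G := y i fun k => s k
  have hlim : Tendsto (fun i => 1 / ((N i : ℝ) + 1)) U (𝓝 0) :=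
    tendsto_one_div_add_atTop_nhds_zero_nat.comp hN
  have hf (s : ℕ → Bool) : M.IsBounded (f s) := by
    refine IsBounded.of_dist hq (D := r + 2) ?_
    filter_upwards [hPN] with i hi
    refine (((hy i hi).1 fun k => s k).2).trans ?_
    have : 1 / ((N i : ℝ) + 1) ≤ 1 := by
      rw [div_le_one (by positivity)]
      have : (0 : ℝ) ≤ N i := Nat.cast_nonneg _
      linarith
    linarith
  refine ⟨fun s => M.point (f s), fun s => ?_, fun s t hst => ?_⟩
  · have ht := M.tendsto _ _ (hf s) hq
    have l1 : Tendsto (fun i => r - 1 / ((N i : ℝ) + 1)) U (𝓝 r) := by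
      simpa using hlim.const_sub r
    have l2 : Tendsto (fun i => r + 2 * (1 / ((N i : ℝ) + 1))) U (𝓝 r) := by
      simpa using (hlim.const_mul 2).const_add r
    refine tendsto_nhds_unique ht (tendsto_of_tendsto_of_tendsto_of_le_of_le' l1 l2 ?_ ?_)
    · exact hPN.mono fun i hi => ((hy i hi).1 fun k => s k).1
    · exact hPN.mono fun i hi => ((hy i hi).1 fun k => s k).2
  · have ht := M.tendsto _ _ (hf s) (hf t)
    obtain ⟨k, hk⟩ := Function.ne_iff.1 hst
    have l1 : Tendsto (fun i => 2 * r - 1 / ((N i : ℝ) + 1)) U (𝓝 (2 * r)) := by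
      simpa using hlim.const_sub (2 * r)
    refine le_of_tendsto_of_tendsto l1 ht ?_
    filter_upwards [hPN, hN.eventually_gt_atTop k] with i hi hki
    exact (hy i hi).2 _ _ fun he => hk (congrFun he ⟨k, hki⟩)

/-- A cone with a branch point is cut by each of its points into `2 ^ ℵ₀` components. -/
theorem valency_eq_continuum (M : ConeModel S U X) (hU : (U : Filter ℕ) ≤ Filter.cofinite)
    (hX : IsRealTree X) {b : X} (hb : IsBranchPoint b) (p : X) :
    valency p = Cardinal.continuum := by
  refine le_antisymm ?_ ?_
  · calc valency p ≤ Cardinal.mk ({p}ᶜ : Set X) :=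
        Cardinal.mk_le_of_surjective ConnectedComponents.surjective_coe
      _ ≤ Cardinal.mk X := Cardinal.mk_set_le _
      _ ≤ Cardinal.continuum := M.mk_le_continuum
  · obtain ⟨r, hr, hbr⟩ := hX.exists_uniform_branches M.isIsometricallyHomogeneous hb
    obtain ⟨x, hx1, hx2⟩ := M.exists_separated_cantor hU p (r := r) fun n => by
      obtain ⟨x, h1, h2⟩ := hX.exists_separated_family hr hbr p
        (ε := 1 / ((n : ℝ) + 1)) (by positivity) (Fintype.card (Fin n → Bool))
      let e := Fintype.equivFin (Fin n → Bool)
      exact ⟨x ∘ e, fun s => h1 _, fun s t hst => h2 _ _ (e.injective.ne hst)⟩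
    have hne (s : ℕ → Bool) : x s ∈ ({p}ᶜ : Set X) := by
      intro he
      have := hx1 s
      rw [Set.mem_singleton_iff.1 he, dist_self] at this
      exact hr.ne this
    have hinj : Function.Injective fun s : ℕ → Bool =>
        ((⟨x s, hne s⟩ : ({p}ᶜ : Set X)) : ConnectedComponents ({p}ᶜ : Set X)) := by
      intro s t hst
      by_contra hn
      refine hX.connectedComponents_ne _ _ ?_ hst
      have h1 := dist_triangle (x s) p (x t)
      have h2 := hx2 s t hn
      unfold IsBetween
      rw [dist_comm p, hx1, hx1] at h1 ⊢
      linarith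
    have := Cardinal.lift_mk_le_lift_mk_of_injective hinj
    simpa [valency] using this

end ConeModel

theorem mainTheorem3 {G : Type*} [Group G] (S : FinGenSet G)
    (U : Ultrafilter ℕ) (hU : (U : Filter ℕ) ≤ Filter.cofinite)
    (g : NSExt U G) (ν : ScalingFactor U)
    {X : Type*} [MetricSpace X] (hX : IsRealTree X) (hcone : Nonempty (X ≃ᵢ GroupAsymptoticCone S U g ν)) :
    (∃ x : X, ∀ y : X, y = x) ∨ Nonempty (X ≃ᵢ ℝ) ∨
      ∀ x : X, valency x = Cardinal.continuum := by
  obtain ⟨e⟩ := hcone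
  obtain ⟨M⟩ := exists_coneModel S U g ν e
  by_cases hb : ∃ b : X, IsBranchPoint b
  · obtain ⟨b, hb⟩ := hb
    exact Or.inr (Or.inr (M.valency_eq_continuum hU hX hb))
  by_cases hpt : ∃ x : X, ∀ y : X, y = x
  · exact Or.inl hpt
  · push Not at hb hpt
    obtain ⟨a, ha⟩ := hpt (M.point M.g)
    exact Or.inr (Or.inl (hX.isometryEquiv_real M.isIsometricallyHomogeneous hb ha))
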